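/- Let $A$ and $B$ be finite-dimensional complex Hilbert spaces, let $\sigma$ be a non-negative operator on $A$, and let $\rho$ be a density operator on $A$ (non-negative, trace one) with $\mathrm{supp}(\rho)\subseteq\mathrm{supp}(\sigma)$. A linear map $\mathcal{N}$ from operators on $A$ to operators on $B$ is called tensor-stable positive if $\mathcal{N}^{\otimes n}$ maps non-negative operators to non-negative operators for every $n\in\mathbb{N}$. With logarithms to base two, let $D(\rho\|\sigma)=\mathrm{tr}\bigl(\rho(\log\rho-\log\sigma)\bigr)$ if $\mathrm{supp}(\rho)\subseteq\mathrm{supp}(\sigma)$ and $D(\rho\|\sigma)=+\infty$ otherwise, and let $D_{\max}(\rho\|\sigma)=\inf\{\gamma\in\mathbb{R}:\rho\le 2^{\gamma}\sigma\}$ (with $\inf\emptyset=+\infty$). Then, for every trace-preserving tensor-stable positive linear map $\mathcal{N}$ from operators on $A$ to operators on $B$, both $D(\rho\|\sigma)$ and $D(\mathcal{N}(\rho)\|\mathcal{N}(\sigma))$ are finite and $$D(\rho\|\sigma)-D\bigl(\mathcal{N}(\rho)\big\|\mathcal{N}(\sigma)\bigr)\;\le\;\min_{\mathcal{R}}\bigl\{D_{\max}\bigl((\mathcal{R}\circ\mathcal{N})(\sigma)\big\|\sigma\bigr):(\mathcal{R}\circ\mathcal{N})(\rho)=\rho\bigr\},$$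 where $\mathcal{R}$ ranges over the trace-preserving tensor-stable positive linear maps from operators on $B$ to operators on $A$; in particular such an $\mathcal{R}$ with $(\mathcal{R}\circ\mathcal{N})(\rho)=\rho$ exists and the minimum is attained. -/

import Mathlib

open scoped ComplexOrder

/-! Finite-dimensional Hilbert spaces are represented in orthonormal bases indexed by finite types
`a`, `b`; operators on them are complex square matrices, and linear maps sending operators on `A`
to operators on `B` are linear maps `Matrix a a ℂ →ₗ[ℂ] Matrix b b ℂ`. -/

namespace QuantumRecovery

/-- A density operator: a non-negative operator of trace one. -/
def IsDensity {a : Type*} [Fintype a] (ρ : Matrix a a ℂ) : Prop :=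
  ρ.PosSemidef ∧ ρ.trace = 1

/-- The support of an operator: the orthogonal complement of its kernel. -/
noncomputable def support {a : Type*} [Fintype a] [DecidableEq a] (ρ : Matrix a a ℂ) :
    Submodule ℂ (EuclideanSpace ℂ a) :=
  (LinearMap.ker (Matrix.toEuclideanLin ρ))ᗮ

/-- The base-two logarithm of a self-adjoint operator, through the functional calculus
(with the usual convention that it vanishes on the kernel of the operator). -/
noncomputable def log2 {a : Type*} [Fintype a] [DecidableEq a] (ρ : Matrix a a ℂ) :
    Matrix a a ℂ :=
  cfc (Real.logb 2) ρ

open Classical in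
/-- The relative entropy `D(ρ‖σ) = tr (ρ (log ρ - log σ))` if the support of `ρ` is included in
the support of `σ`, and `+∞` otherwise. -/
noncomputable def relEntropy {a : Type*} [Fintype a] [DecidableEq a] (ρ σ : Matrix a a ℂ) :
    EReal :=
  if support ρ ≤ support σ then (((ρ * (log2 ρ - log2 σ)).trace.re : ℝ) : EReal) else ⊤

/-- The max relative entropy `D_max(ρ‖σ) = inf {γ : ρ ≤ 2 ^ γ σ}`, an infimum over real `γ`
that is `+∞` when no such `γ` exists. -/
noncomputable def maxRelEntropy {a : Type*} [Fintype a] (ρ σ : Matrix a a ℂ) : EReal :=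
  sInf {d : EReal | ∃ γ : ℝ, d = (γ : EReal) ∧ (((2 : ℝ) ^ γ) • σ - ρ).PosSemidef}

/-- A linear map is positive if it sends non-negative operators to non-negative operators. -/
def IsPositiveMap {a b : Type*} [Fintype a] [Fintype b]
    (N : Matrix a a ℂ →ₗ[ℂ] Matrix b b ℂ) : Prop :=
  ∀ X : Matrix a a ℂ, X.PosSemidef → (N X).PosSemidef

/-- A linear map is trace-preserving. -/
def IsTracePreserving {a b : Type*} [Fintype a] [Fintype b]
    (N : Matrix a a ℂ →ₗ[ℂ] Matrix b b ℂ) : Prop :=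
  ∀ X : Matrix a a ℂ, (N X).trace = X.trace

/-- The tensor product `X 0 ⊗ ⋯ ⊗ X (n - 1)` of operators, an operator on the `n`-th tensor power,
which has the product basis indexed by `Fin n → a`. -/
def tensorProd {a : Type*} {n : ℕ} (X : Fin n → Matrix a a ℂ) :
    Matrix (Fin n → a) (Fin n → a) ℂ :=
  Matrix.of fun i j => ∏ t, X t (i t) (j t)

/-- The tensor power `N^{⊗ n}` of a linear map on operators: the linear map that sends a tensor
product of matrix units to the tensor product of their images. -/
noncomputable def tensorPow {a b : Type*} [Fintype a] [DecidableEq a]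
    (N : Matrix a a ℂ →ₗ[ℂ] Matrix b b ℂ) (n : ℕ) :
    Matrix (Fin n → a) (Fin n → a) ℂ →ₗ[ℂ] Matrix (Fin n → b) (Fin n → b) ℂ where
  toFun X := ∑ k, ∑ l, X k l • tensorProd fun t => N (Matrix.single (k t) (l t) 1)
  map_add' X Y := by simp [add_smul, Finset.sum_add_distrib]
  map_smul' c X := by simp [mul_smul, Finset.smul_sum]

/-- `N^{⊗ n}` sends `X 0 ⊗ ⋯ ⊗ X (n - 1)` to `N (X 0) ⊗ ⋯ ⊗ N (X (n - 1))`. -/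
theorem tensorPow_tensorProd {a b : Type*} [Fintype a] [DecidableEq a]
    (N : Matrix a a ℂ →ₗ[ℂ] Matrix b b ℂ) {n : ℕ} (X : Fin n → Matrix a a ℂ) :
    tensorPow N n (tensorProd X) = tensorProd fun t => N (X t) := by
  have key : ∀ (Y : Matrix a a ℂ) (i j : b),
      N Y i j = ∑ p : a × a, Y p.1 p.2 * N (Matrix.single p.1 p.2 1) i j := by
    intro Y i j
    conv_lhs => rw [Matrix.matrix_eq_sum_single Y]
    simp only [map_sum, Matrix.sum_apply, Fintype.sum_prod_type]
    refine Finset.sum_congr rfl fun k _ => Finset.sum_congr rfl fun l _ => ?_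
    have h : Matrix.single k l (Y k l) = Y k l • Matrix.single k l (1 : ℂ) := by
      simp [Matrix.smul_single]
    rw [h, map_smul, Matrix.smul_apply, smul_eq_mul]
  ext i j
  simp only [tensorPow, LinearMap.coe_mk, AddHom.coe_mk, Matrix.sum_apply, Matrix.smul_apply,
    tensorProd, Matrix.of_apply, smul_eq_mul, ← Finset.prod_mul_distrib]
  simp_rw [key (X _)]
  rw [Finset.prod_univ_sum, Fintype.piFinset_univ, ← Fintype.sum_prod_type',
    ← (Equiv.arrowProdEquivProdArrow (Fin n) (fun _ => a) (fun _ => a)).sum_comp]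
  rfl

/-- A linear map is tensor-stable positive if all of its tensor powers are positive. -/
def IsTensorStablePositive {a b : Type*} [Fintype a] [DecidableEq a] [Fintype b]
    (N : Matrix a a ℂ →ₗ[ℂ] Matrix b b ℂ) : Prop :=
  ∀ n : ℕ, IsPositiveMap (tensorPow N n)

end QuantumRecovery

/-! Fix a recovery map `R` and put `ρ' = N ρ`, `σ' = N σ`, so that `R ρ' = ρ`; suppose `R σ' ≤ c σ`
with `c = 2 ^ γ`. The inequality is the derivative at 0 of a three-lines bound for G(z) = tr (P ρ^z
σ^(-z/2) R(σ'^(z/2) ρ'^(1-z) σ'^(z/2)) σ^(-z/2)), P the support projection of ρ. On Re z = 0 the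
powers are unitary and |G| ≤ 1, because the trace adjoint of `R` is positive and unital
(`norm_interp_le_of_re_eq_zero`). On Re z = 1 the half powers turn `R` into the positive map X ↦
σ^(-1/2) R(σ'^(1/2) X σ'^(1/2)) σ^(-1/2), whose value at 1 is at most c, and |G| ≤ c
(`norm_interp_le_of_re_eq_one`). Both bounds rest on Russo–Dye (`norm_map_unitary_le`). Hence |G(x)|
≤ c^x on [0, 1] with equality at 0, so Re G'(0) ≤ log c, and G'(0) is the difference of the relative
entropies in natural logarithms (`re_trace_mul_logM_sub_le`).

This uses only positivity of `R`. Tensor-stability matters for the minimum: it is a closed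
condition, and positive trace-preserving maps are uniformly bounded, so feasible pairs (`R`, `γ`)
with bounded `γ` form a compact set (`isCompact_recoverySet`). The map replacing its input by ρ
shows that the feasible set is never empty. -/

namespace QuantumRecovery

/-! ### Functions of a Hermitian matrix. -/

section SpectralFunction

variable {n : Type*} [Fintype n] [DecidableEq n] {A : Matrix n n ℂ}

/-- A complex-valued function of a Hermitian matrix, evaluated on an orthonormal eigenbasis. -/
noncomputable def specFun (hA : A.IsHermitian) (f : ℝ → ℂ) : Matrix n n ℂ :=
  (hA.eigenvectorUnitary : Matrix n n ℂ) * Matrix.diagonal (fun i => f (hA.eigenvalues i)) *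
    star (hA.eigenvectorUnitary : Matrix n n ℂ)

theorem specFun_congr (hA : A.IsHermitian) {f g : ℝ → ℂ}
    (h : ∀ i, f (hA.eigenvalues i) = g (hA.eigenvalues i)) : specFun hA f = specFun hA g := by
  simp only [specFun, h]

theorem specFun_mul (hA : A.IsHermitian) (f g : ℝ → ℂ) :
    specFun hA f * specFun hA g = specFun hA fun x => f x * g x := by
  have h : star (hA.eigenvectorUnitary : Matrix n n ℂ) *
      (hA.eigenvectorUnitary : Matrix n n ℂ) = 1 :=
    Unitary.coe_star_mul_self _
  simp only [specFun]
  rw [show ∀ a b c d e : Matrix n n ℂ, a * b * c * (d * e * c) = a * b * (c * d) * e * c by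
    intros; simp only [mul_assoc]]
  rw [h, mul_one, mul_assoc _ (Matrix.diagonal _) (Matrix.diagonal _), Matrix.diagonal_mul_diagonal]

theorem specFun_one (hA : A.IsHermitian) : specFun hA (fun _ => 1) = 1 := by
  simp [specFun]

theorem specFun_id (hA : A.IsHermitian) : specFun hA (fun x => (x : ℂ)) = A := by
  conv_rhs => rw [hA.spectral_theorem]
  rfl

theorem self_mul_specFun (hA : A.IsHermitian) (f : ℝ → ℂ) :
    A * specFun hA f = specFun hA fun x => x * f x :=
  (congrArg (· * specFun hA f) (specFun_id hA)).symm.trans (specFun_mul hA _ _)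

theorem specFun_mul_self (hA : A.IsHermitian) (f : ℝ → ℂ) :
    specFun hA f * A = specFun hA fun x => f x * x :=
  (congrArg (specFun hA f * ·) (specFun_id hA)).symm.trans (specFun_mul hA _ _)

theorem specFun_conjTranspose (hA : A.IsHermitian) (f : ℝ → ℂ) :
    (specFun hA f).conjTranspose = specFun hA fun x => star (f x) := by
  simp only [specFun, Matrix.conjTranspose_mul, Matrix.star_eq_conjTranspose,
    Matrix.conjTranspose_conjTranspose, Matrix.diagonal_conjTranspose, mul_assoc]
  rfl

theorem cfc_eq_specFun (hA : A.IsHermitian) (f : ℝ → ℝ) :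
    cfc f A = specFun hA fun x => (f x : ℂ) := by
  rw [hA.cfc_eq]
  rfl

theorem specFun_posSemidef (hA : A.IsHermitian) {f : ℝ → ℂ}
    (h : ∀ i, 0 ≤ f (hA.eigenvalues i)) : (specFun hA f).PosSemidef := by
  have hd := Matrix.PosSemidef.diagonal (d := fun i => f (hA.eigenvalues i)) h
  exact hd.mul_mul_conjTranspose_same (hA.eigenvectorUnitary : Matrix n n ℂ)

theorem specFun_smul (hA : A.IsHermitian) (c : ℂ) (f : ℝ → ℂ) :
    specFun hA (fun x => c * f x) = c • specFun hA f := by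
  have : Matrix.diagonal (fun i => c * f (hA.eigenvalues i))
      = c • Matrix.diagonal (fun i => f (hA.eigenvalues i)) := by
    rw [← Matrix.diagonal_smul]; rfl
  simp [specFun, this]

theorem specFun_mem_unitary (hA : A.IsHermitian) {f : ℝ → ℂ}
    (h : ∀ i, ‖f (hA.eigenvalues i)‖ = 1) : specFun hA f ∈ unitary (Matrix n n ℂ) := by
  have key : ∀ i, star (f (hA.eigenvalues i)) * f (hA.eigenvalues i) = 1 := fun i => by
    rw [Complex.star_def, ← Complex.normSq_eq_conj_mul_self, Complex.normSq_eq_norm_sq, h i]; simp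
  rw [Unitary.mem_iff, Matrix.star_eq_conjTranspose, specFun_conjTranspose, specFun_mul,
    specFun_mul, ← specFun_one hA]
  exact ⟨specFun_congr hA key, specFun_congr hA fun i => by rw [mul_comm]; exact key i⟩

open scoped Matrix.Norms.L2Operator in
theorem norm_specFun_le (hA : A.IsHermitian) {f : ℝ → ℂ} {C : ℝ} (hC : 0 ≤ C)
    (h : ∀ i, ‖f (hA.eigenvalues i)‖ ≤ C) : ‖specFun hA f‖ ≤ C := by
  rw [specFun, CStarRing.norm_mul_mem_unitary, CStarRing.norm_mem_unitary_mul,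
    Matrix.l2_opNorm_diagonal]
  · exact (pi_norm_le_iff_of_nonneg hC).2 h
  · exact hA.eigenvectorUnitary.2
  · exact (star hA.eigenvectorUnitary).2

end SpectralFunction

/-! ### Logarithms, complex powers and support projections. -/

section Powers

variable {n : Type*} [Fintype n] [DecidableEq n] {A : Matrix n n ℂ}

/-- The logarithm of a Hermitian matrix, which vanishes on the kernel. -/
noncomputable def logM (hA : A.IsHermitian) : Matrix n n ℂ := specFun hA fun x => (Real.log x : ℂ)

/-- The orthogonal projection onto the support of a Hermitian matrix. -/
noncomputable def suppProj (hA : A.IsHermitian) : Matrix n n ℂ :=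
  specFun hA fun x => if x = 0 then 0 else 1

/-- The exponential of `z` times the logarithm of a Hermitian matrix: its complex power on the
support, and the identity on the kernel. -/
noncomputable def powM (hA : A.IsHermitian) (z : ℂ) : Matrix n n ℂ :=
  specFun hA fun x => Complex.exp (z * (Real.log x : ℂ))

/-- The square root of a positive semidefinite matrix. -/
noncomputable def sqrtM (hA : A.IsHermitian) : Matrix n n ℂ :=
  specFun hA fun x => (Real.sqrt x : ℂ)

theorem log2_eq (hA : A.IsHermitian) : log2 A = ((Real.log 2)⁻¹ : ℂ) • logM hA := by
  rw [log2, cfc_eq_specFun hA, logM, ← specFun_smul]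
  refine specFun_congr hA fun i => ?_
  rw [Real.logb]
  push_cast
  rw [div_eq_inv_mul]

theorem powM_add (hA : A.IsHermitian) (z w : ℂ) : powM hA (z + w) = powM hA z * powM hA w := by
  simp only [powM, specFun_mul, add_mul, Complex.exp_add]

theorem powM_zero (hA : A.IsHermitian) : powM hA 0 = 1 := by
  simp [powM, specFun_one]

theorem suppProj_mul_self (hA : A.IsHermitian) : suppProj hA * suppProj hA = suppProj hA := by
  rw [suppProj, specFun_mul]
  exact specFun_congr hA fun i => by simp

theorem suppProj_posSemidef (hA : A.IsHermitian) : (suppProj hA).PosSemidef :=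
  specFun_posSemidef hA fun i => by split_ifs <;> simp

theorem one_sub_suppProj_posSemidef (hA : A.IsHermitian) : (1 - suppProj hA).PosSemidef := by
  have h : (1 - suppProj hA).conjTranspose * (1 - suppProj hA) = 1 - suppProj hA := by
    rw [Matrix.conjTranspose_sub, Matrix.conjTranspose_one, (suppProj_posSemidef hA).1]
    simp [sub_mul, mul_sub, suppProj_mul_self]
  rw [← h]
  exact Matrix.posSemidef_conjTranspose_mul_self _

theorem suppProj_mul (hA : A.IsHermitian) : suppProj hA * A = A := by
  rw [suppProj, specFun_mul_self]
  conv_rhs => rw [← specFun_id hA]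
  exact specFun_congr hA fun i => by split_ifs with h <;> simp [h]

theorem mul_suppProj (hA : A.IsHermitian) : A * suppProj hA = A := by
  rw [suppProj, self_mul_specFun]
  conv_rhs => rw [← specFun_id hA]
  exact specFun_congr hA fun i => by split_ifs with h <;> simp [h]

theorem suppProj_mul_logM (hA : A.IsHermitian) : suppProj hA * logM hA = logM hA := by
  rw [suppProj, logM, specFun_mul]
  exact specFun_congr hA fun i => by split_ifs with h <;> simp [h]

theorem suppProj_mul_powM (hA : A.IsHermitian) (z : ℂ) :
    suppProj hA * powM hA z = powM hA z * suppProj hA := by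
  simp only [suppProj, powM, specFun_mul, mul_comm]

theorem powM_mul_self (hA : A.IsHermitian) (z : ℂ) : powM hA z * A = A * powM hA z := by
  rw [powM, specFun_mul_self, self_mul_specFun]
  exact specFun_congr hA fun i => mul_comm _ _

theorem ofReal_mul_exp_neg_log {x : ℝ} (hx : 0 ≤ x) :
    (x : ℂ) * Complex.exp (-1 * (Real.log x : ℂ)) = if x = 0 then 0 else 1 := by
  split_ifs with h
  · simp [h]
  · have hx' : 0 < x := lt_of_le_of_ne hx (Ne.symm h)
    rw [neg_one_mul, Complex.exp_neg, ← Complex.ofReal_exp, Real.exp_log hx']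
    exact mul_inv_cancel₀ (by exact_mod_cast h)

/-- Exhibits the support projection as a right multiple of `A`, so that whatever annihilates `A`
from the left annihilates the projection. -/
theorem self_mul_powM_neg_one (hA : A.PosSemidef) : A * powM hA.1 (-1) = suppProj hA.1 := by
  rw [powM, suppProj, self_mul_specFun]
  exact specFun_congr hA.1 fun i => ofReal_mul_exp_neg_log (hA.eigenvalues_nonneg i)

theorem suppProj_mul_powM_one (hA : A.PosSemidef) : suppProj hA.1 * powM hA.1 1 = A := by
  rw [← self_mul_powM_neg_one hA, mul_assoc, ← powM_add]
  simp [powM_zero]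

theorem powM_half_mul_suppProj (hA : A.PosSemidef) :
    powM hA.1 (1 / 2) * suppProj hA.1 = sqrtM hA.1 := by
  rw [powM, suppProj, sqrtM, specFun_mul]
  refine specFun_congr hA.1 fun i => ?_
  have hx := hA.eigenvalues_nonneg i
  generalize hA.1.eigenvalues i = x at hx ⊢
  split_ifs with h
  · simp [h]
  · have hx' : 0 < x := lt_of_le_of_ne hx (Ne.symm h)
    rw [mul_one, Real.sqrt_eq_rpow, Real.rpow_def_of_pos hx']
    push_cast
    rw [mul_comm]

theorem sqrtM_mul_self (hA : A.PosSemidef) : sqrtM hA.1 * sqrtM hA.1 = A := by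
  rw [sqrtM, specFun_mul]
  conv_rhs => rw [← specFun_id hA.1]
  exact specFun_congr hA.1 fun i => by
    rw [← Complex.ofReal_mul, Real.mul_self_sqrt (hA.eigenvalues_nonneg i)]

theorem sqrtM_isHermitian (hA : A.IsHermitian) : (sqrtM hA).IsHermitian := by
  rw [Matrix.IsHermitian, sqrtM, specFun_conjTranspose]
  exact specFun_congr hA fun i => by simp

theorem powM_ofReal_isHermitian (hA : A.IsHermitian) (x : ℝ) : (powM hA x).IsHermitian := by
  rw [Matrix.IsHermitian, powM, specFun_conjTranspose]
  exact specFun_congr hA fun i => by simp [← Complex.exp_conj]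

theorem powM_mem_unitary (hA : A.IsHermitian) {z : ℂ} (hz : z.re = 0) :
    powM hA z ∈ unitary (Matrix n n ℂ) :=
  specFun_mem_unitary hA fun i => by simp [Complex.norm_exp, hz]

open scoped Matrix.Norms.L2Operator in
-- The modulus of exp (z log x) depends only on Re z; this supplies the boundedness needed for the
-- three-lines theorem.
theorem exists_norm_powM_le (hA : A.IsHermitian) :
    ∃ C : ℝ, 0 ≤ C ∧ ∀ z : ℂ, |z.re| ≤ 1 → ‖powM hA z‖ ≤ C := by
  refine ⟨∑ i, Real.exp |Real.log (hA.eigenvalues i)|, by positivity, fun z hz => ?_⟩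
  refine norm_specFun_le hA (by positivity) fun i => ?_
  refine le_trans ?_ (Finset.single_le_sum (f := fun i => Real.exp |Real.log (hA.eigenvalues i)|)
    (fun i _ => (Real.exp_pos _).le) (Finset.mem_univ i))
  rw [Complex.norm_exp, Complex.re_mul_ofReal]
  refine Real.exp_le_exp.2 ((le_abs_self _).trans ?_)
  rw [abs_mul]
  exact mul_le_of_le_one_left (abs_nonneg _) hz

open scoped Matrix.Norms.L2Operator in
theorem hasDerivAt_powM (hA : A.IsHermitian) (z : ℂ) :
    HasDerivAt (powM hA) (logM hA * powM hA z) z := by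
  have hdiag : HasDerivAt (fun z : ℂ => Matrix.diagonal fun i =>
      Complex.exp (z * (Real.log (hA.eigenvalues i) : ℂ)))
      (Matrix.diagonal fun i => (Real.log (hA.eigenvalues i) : ℂ) *
        Complex.exp (z * (Real.log (hA.eigenvalues i) : ℂ))) z := by
    have h := (LinearMap.toContinuousLinearMap
      (Matrix.diagonalLinearMap n ℂ ℂ)).hasFDerivAt.comp_hasDerivAt z
      (hasDerivAt_pi.2 fun i => ((hasDerivAt_mul_const (x := z)
        (Real.log (hA.eigenvalues i) : ℂ)).cexp))
    convert! h using 1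
    · simp only [mul_comm]
      rfl
  rw [logM, powM, specFun_mul]
  exact (hdiag.const_mul (hA.eigenvectorUnitary : Matrix n n ℂ)).mul_const
    (star (hA.eigenvectorUnitary : Matrix n n ℂ))

end Powers

section OperatorNorm

open scoped Matrix.Norms.L2Operator

/-! ### Norm bounds for positive maps and trace inequalities. -/

section Contraction

variable {n : Type*} [Fintype n] [DecidableEq n] {m : Type*} [Fintype m] [DecidableEq m]

theorem inner_conjTranspose_mul (B C : Matrix n n ℂ) (v w : EuclideanSpace ℂ n) :
    inner ℂ v (Matrix.toEuclideanCLM (𝕜 := ℂ) (B.conjTranspose * C) w) =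
      inner ℂ (Matrix.toEuclideanCLM (𝕜 := ℂ) B v) (Matrix.toEuclideanCLM (𝕜 := ℂ) C w) := by
  rw [map_mul, ← Matrix.star_eq_conjTranspose, map_star, ContinuousLinearMap.star_eq_adjoint,
    mul_apply_eq_comp, ContinuousLinearMap.adjoint_inner_right]

theorem inner_posSemidef {P : Matrix n n ℂ} (hP : P.PosSemidef) (v w : EuclideanSpace ℂ n) :
    inner ℂ v (Matrix.toEuclideanCLM (𝕜 := ℂ) P w) =
      inner ℂ (Matrix.toEuclideanCLM (𝕜 := ℂ) (sqrtM hP.1) v)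
        (Matrix.toEuclideanCLM (𝕜 := ℂ) (sqrtM hP.1) w) := by
  rw [← inner_conjTranspose_mul, (sqrtM_isHermitian hP.1).eq, sqrtM_mul_self hP]

theorem re_inner_posSemidef {P : Matrix n n ℂ} (hP : P.PosSemidef) (v : EuclideanSpace ℂ n) :
    (inner ℂ v (Matrix.toEuclideanCLM (𝕜 := ℂ) P v)).re =
      ‖Matrix.toEuclideanCLM (𝕜 := ℂ) (sqrtM hP.1) v‖ ^ 2 := by
  rw [inner_posSemidef hP]
  exact inner_self_eq_norm_sq (𝕜 := ℂ) _

/-- Cauchy–Schwarz followed by the arithmetic-geometric mean inequality. The bound is linear in `P`,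
so it can be summed over a decomposition of the identity. -/
theorem norm_inner_posSemidef_le {P : Matrix n n ℂ} (hP : P.PosSemidef)
    (v w : EuclideanSpace ℂ n) :
    ‖inner ℂ v (Matrix.toEuclideanCLM (𝕜 := ℂ) P w)‖ ≤
      ((inner ℂ v (Matrix.toEuclideanCLM (𝕜 := ℂ) P v)).re +
        (inner ℂ w (Matrix.toEuclideanCLM (𝕜 := ℂ) P w)).re) / 2 := by
  rw [re_inner_posSemidef hP, re_inner_posSemidef hP, inner_posSemidef hP]
  refine (norm_inner_le_norm _ _).trans ?_
  nlinarith [sq_nonneg (‖Matrix.toEuclideanCLM (𝕜 := ℂ) (sqrtM hP.1) v‖ -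
    ‖Matrix.toEuclideanCLM (𝕜 := ℂ) (sqrtM hP.1) w‖)]

theorem norm_le_of_norm_inner_le {K : Matrix n n ℂ} {c : ℝ} (hc : 0 ≤ c)
    (h : ∀ v w : EuclideanSpace ℂ n, ‖inner ℂ v (Matrix.toEuclideanCLM (𝕜 := ℂ) K w)‖ ≤
      c * (‖v‖ ^ 2 + ‖w‖ ^ 2) / 2) : ‖K‖ ≤ c := by
  rw [← Matrix.l2_opNorm_toEuclideanCLM]
  refine ContinuousLinearMap.opNorm_le_bound _ hc fun x => ?_
  set y := Matrix.toEuclideanCLM (𝕜 := ℂ) K x with hy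
  rcases eq_or_ne y 0 with h0 | h0
  · rw [h0, norm_zero]; positivity
  rcases eq_or_ne x 0 with hx | hx
  · rw [hy, hx, map_zero, norm_zero]; positivity
  have hy' : 0 < ‖y‖ := norm_pos_iff.2 h0
  have hx' : 0 < ‖x‖ := norm_pos_iff.2 hx
  -- Rescaling `y` to the length of `x` makes the arithmetic mean of the squares equal to the
  -- product, so nothing is lost.
  have := h (((‖x‖ / ‖y‖ : ℝ) : ℂ) • y) x
  rw [← hy, inner_smul_left, norm_mul, norm_smul, inner_self_eq_norm_sq_to_K, Complex.conj_ofReal,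
    Complex.norm_real, norm_pow] at this
  simp only [norm_div, norm_norm, Complex.coe_algebraMap, Complex.norm_real] at this
  have e1 : ‖x‖ / ‖y‖ * ‖y‖ ^ 2 = ‖x‖ * ‖y‖ := by field_simp
  have e2 : ‖x‖ / ‖y‖ * ‖y‖ = ‖x‖ := by field_simp
  rw [e1, e2] at this
  nlinarith

/-- A unitary matrix is a combination, with coefficients of modulus one, of projections that add up
to the identity. -/
theorem exists_unitary_decomposition {U : Matrix n n ℂ} (hU : U ∈ unitary (Matrix n n ℂ)) :
    ∃ (s : Finset ℂ) (E : ℂ → Matrix n n ℂ), (∀ z ∈ s, ‖z‖ = 1) ∧ (∀ z, (E z).PosSemidef) ∧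
      ∑ z ∈ s, E z = 1 ∧ ∑ z ∈ s, z • E z = U := by
  classical
  -- Every function is continuous on a finite spectrum, so indicators of single eigenvalues are
  -- admissible and give the spectral projections.
  have hfin : (spectrum ℂ U).Finite := Matrix.finite_spectrum U
  have hn : IsStarNormal U := ⟨by
    rw [commute_iff_eq, Unitary.star_mul_self_of_mem hU, Unitary.mul_star_self_of_mem hU]⟩
  have hcont : ∀ f : ℂ → ℂ, ContinuousOn f (spectrum ℂ U) := fun f => hfin.continuousOn f
  let f : ℂ → ℂ → ℂ := fun z x => if x = z then 1 else 0
  refine ⟨hfin.toFinset, fun z => cfc (f z) U, fun z hz => ?_, fun z => ?_, ?_, ?_⟩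
  · exact spectrum.norm_eq_one_of_unitary hU (hfin.mem_toFinset.1 hz)
  · have h : (cfc (f z) U).conjTranspose * cfc (f z) U = cfc (f z) U := by
      rw [← Matrix.star_eq_conjTranspose, ← cfc_star, ← cfc_mul _ _ _ (hcont _) (hcont _)]
      congr 1
      ext x
      simp only [f]
      split_ifs <;> simp
    have h' := Matrix.posSemidef_conjTranspose_mul_self (cfc (f z) U)
    rwa [h] at h'
  · rw [← cfc_sum _ _ _ fun _ _ => hcont _]
    conv_rhs => rw [← cfc_const_one ℂ U]
    refine cfc_congr fun x hx => ?_
    simp only [f, Finset.sum_apply]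
    rw [Finset.sum_ite_eq, if_pos (hfin.mem_toFinset.2 hx)]
  · conv_rhs => rw [← cfc_id ℂ U]
    simp_rw [← cfc_smul _ _ _ (hcont _)]
    rw [← cfc_sum _ _ _ fun _ _ => hcont _]
    refine cfc_congr fun x hx => ?_
    simp only [f, Finset.sum_apply, smul_eq_mul, mul_ite, mul_one, mul_zero, id]
    rw [Finset.sum_ite_eq, if_pos (hfin.mem_toFinset.2 hx)]

/-- The Russo–Dye theorem: a positive map attains its norm on unitaries at the identity. -/
theorem norm_map_unitary_le {Φ : Matrix n n ℂ →ₗ[ℂ] Matrix m m ℂ} (hΦ : IsPositiveMap Φ) {c : ℝ}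
    (hc : 0 ≤ c) (h1 : ((c : ℂ) • 1 - Φ 1).PosSemidef) {U : Matrix n n ℂ}
    (hU : U ∈ unitary (Matrix n n ℂ)) : ‖Φ U‖ ≤ c := by
  obtain ⟨s, E, hs, hE, hE1, hEU⟩ := exists_unitary_decomposition hU
  have hone : ∀ v : EuclideanSpace ℂ m,
      (inner ℂ v (Matrix.toEuclideanCLM (𝕜 := ℂ) (Φ 1) v)).re ≤ c * ‖v‖ ^ 2 := fun v => by
    have h := re_inner_posSemidef h1 v
    rw [map_sub, map_smul, map_one, sub_apply, inner_sub_right,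
      smul_apply, inner_smul_right, one_apply_eq_self,
      Complex.sub_re, Complex.re_ofReal_mul] at h
    have h2 : (inner ℂ v v : ℂ).re = ‖v‖ ^ 2 := inner_self_eq_norm_sq (𝕜 := ℂ) v
    rw [h2] at h
    nlinarith [sq_nonneg ‖Matrix.toEuclideanCLM (𝕜 := ℂ) (sqrtM h1.1) v‖]
  have hsum : ∀ v : EuclideanSpace ℂ m,
      (inner ℂ v (Matrix.toEuclideanCLM (𝕜 := ℂ) (Φ 1) v)).re =
        ∑ z ∈ s, (inner ℂ v (Matrix.toEuclideanCLM (𝕜 := ℂ) (Φ (E z)) v)).re := fun v => by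
    rw [← hE1, map_sum, map_sum, sum_apply, inner_sum, Complex.re_sum]
  refine norm_le_of_norm_inner_le hc fun v w => ?_
  rw [← hEU, map_sum, map_sum, sum_apply, inner_sum]
  -- The phases have modulus one and drop out; the remaining positive operators `Φ (E z)` add up to
  -- `Φ 1`.
  calc _ ≤ ∑ z ∈ s, ‖inner ℂ v (Matrix.toEuclideanCLM (𝕜 := ℂ) (Φ (z • E z)) w)‖ :=
        norm_sum_le _ _
    _ ≤ ∑ z ∈ s, ((inner ℂ v (Matrix.toEuclideanCLM (𝕜 := ℂ) (Φ (E z)) v)).re +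
          (inner ℂ w (Matrix.toEuclideanCLM (𝕜 := ℂ) (Φ (E z)) w)).re) / 2 := by
        refine Finset.sum_le_sum fun z hz => ?_
        rw [map_smul, map_smul, smul_apply, inner_smul_right, norm_mul, hs z hz,
          one_mul]
        exact norm_inner_posSemidef_le (hΦ _ (hE z)) v w
    _ = ((inner ℂ v (Matrix.toEuclideanCLM (𝕜 := ℂ) (Φ 1) v)).re +
          (inner ℂ w (Matrix.toEuclideanCLM (𝕜 := ℂ) (Φ 1) w)).re) / 2 := by
        rw [hsum v, hsum w, ← Finset.sum_div, Finset.sum_add_distrib]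
    _ ≤ _ := by linarith [hone v, hone w]

/-- A projection is the average of 1 and the reflection 2P - 1, so VPW is the average of two
unitaries and Russo–Dye applies to each. -/
theorem norm_map_unitary_mul_proj_mul_unitary_le {Φ : Matrix n n ℂ →ₗ[ℂ] Matrix m m ℂ}
    (hΦ : IsPositiveMap Φ) {c : ℝ} (hc : 0 ≤ c) (h1 : ((c : ℂ) • 1 - Φ 1).PosSemidef)
    {V P W : Matrix n n ℂ} (hV : V ∈ unitary (Matrix n n ℂ)) (hP : P.IsHermitian) (hPP : P * P = P)
    (hW : W ∈ unitary (Matrix n n ℂ)) : ‖Φ (V * P * W)‖ ≤ c := by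
  have hR : (2 : ℂ) • P - 1 ∈ unitary (Matrix n n ℂ) := by
    have hsa : star ((2 : ℂ) • P - 1) = (2 : ℂ) • P - 1 := by
      rw [Matrix.star_eq_conjTranspose, Matrix.conjTranspose_sub, Matrix.conjTranspose_smul,
        hP.eq, Matrix.conjTranspose_one]
      simp
    have hsq : ((2 : ℂ) • P - 1) * ((2 : ℂ) • P - 1) = 1 := by
      simp only [sub_mul, mul_sub, smul_mul_assoc, mul_smul_comm, hPP, mul_one, one_mul]
      module
    exact Unitary.mem_iff.2 ⟨by rw [hsa, hsq], by rw [hsa, hsq]⟩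
  have hdec : V * P * W = (2 : ℂ)⁻¹ • (V * W) + (2 : ℂ)⁻¹ • (V * ((2 : ℂ) • P - 1) * W) := by
    simp only [mul_sub, sub_mul, smul_mul_assoc, mul_smul_comm, mul_one]
    module
  rw [hdec, map_add, map_smul, map_smul]
  refine (norm_add_le _ _).trans ?_
  rw [norm_smul, norm_smul]
  have b1 := norm_map_unitary_le hΦ hc h1 (mul_mem hV hW)
  have b2 := norm_map_unitary_le hΦ hc h1 (mul_mem (mul_mem hV hR) hW)
  have : ‖(2 : ℂ)⁻¹‖ = 1 / 2 := by simp
  rw [this]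
  linarith

/-- Split ρ into two square roots and apply Cauchy–Schwarz to each diagonal entry of √ρ K √ρ. -/
theorem norm_trace_mul_le (K : Matrix n n ℂ) {ρ : Matrix n n ℂ} (hρ : ρ.PosSemidef) :
    ‖(K * ρ).trace‖ ≤ ‖K‖ * ρ.trace.re := by
  have hdiag : ∀ (M : Matrix n n ℂ) (i : n), M i i = inner ℂ (EuclideanSpace.single i (1 : ℂ))
      (Matrix.toEuclideanCLM (𝕜 := ℂ) M (EuclideanSpace.single i 1)) := fun M i => by
    simp [EuclideanSpace.inner_single_left, Matrix.ofLp_toEuclideanCLM]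
  have hB := sqrtM_mul_self hρ
  have htr : (K * ρ).trace = ((sqrtM hρ.1).conjTranspose * (K * sqrtM hρ.1)).trace := by
    rw [(sqrtM_isHermitian hρ.1).eq, Matrix.trace_mul_comm (sqrtM hρ.1), mul_assoc K, hB]
  rw [htr, Matrix.trace, Matrix.trace, Complex.re_sum, Finset.mul_sum]
  refine (norm_sum_le _ _).trans (Finset.sum_le_sum fun i _ => ?_)
  rw [Matrix.diag_apply, Matrix.diag_apply, hdiag (_ * _) i, hdiag ρ i, inner_conjTranspose_mul,
    re_inner_posSemidef hρ, map_mul, mul_apply_eq_comp]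
  refine (norm_inner_le_norm _ _).trans ?_
  refine (mul_le_mul_of_nonneg_left (ContinuousLinearMap.le_opNorm _ _) (norm_nonneg _)).trans ?_
  rw [Matrix.l2_opNorm_toEuclideanCLM]
  exact le_of_eq (by ring)

/-- tr (MA) is the squared Hilbert–Schmidt norm of √M √A. -/
theorem mul_eq_zero_of_trace_mul_eq_zero {M A : Matrix n n ℂ} (hM : M.PosSemidef)
    (hA : A.PosSemidef) (h : (M * A).trace = 0) : M * A = 0 := by
  have h0 : ((sqrtM hM.1 * sqrtM hA.1).conjTranspose * (sqrtM hM.1 * sqrtM hA.1)).trace = 0 := by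
    rw [Matrix.conjTranspose_mul, (sqrtM_isHermitian hM.1).eq, (sqrtM_isHermitian hA.1).eq,
      mul_assoc, Matrix.trace_mul_comm, ← mul_assoc, sqrtM_mul_self hM, mul_assoc,
      sqrtM_mul_self hA, h]
  have h1 := Matrix.trace_conjTranspose_mul_self_eq_zero_iff.1 h0
  rw [← sqrtM_mul_self hM, ← sqrtM_mul_self hA, mul_assoc, ← mul_assoc (sqrtM hM.1) (sqrtM hA.1),
    h1, zero_mul, mul_zero]

theorem trace_mul_nonneg {M A : Matrix n n ℂ} (hM : M.PosSemidef) (hA : A.PosSemidef) :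
    0 ≤ (M * A).trace := by
  have h := (hA.conjTranspose_mul_mul_same (sqrtM hM.1)).trace_nonneg
  rwa [(sqrtM_isHermitian hM.1).eq, mul_assoc, Matrix.trace_mul_comm, mul_assoc,
    sqrtM_mul_self hM, Matrix.trace_mul_comm] at h

end Contraction

/-! ### The adjoint for the trace pairing. -/

section Adjoint

variable {n : Type*} [Fintype n] [DecidableEq n] {m : Type*} [Fintype m] [DecidableEq m]

/-- The adjoint of a linear map on matrices for the trace pairing. -/
noncomputable def traceAdjoint (T : Matrix n n ℂ →ₗ[ℂ] Matrix m m ℂ) :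
    Matrix m m ℂ →ₗ[ℂ] Matrix n n ℂ where
  toFun C := Matrix.of fun i j => (C * T (Matrix.single j i 1)).trace
  map_add' C D := by ext; simp [add_mul]
  map_smul' c C := by ext; simp

theorem trace_traceAdjoint_mul (T : Matrix n n ℂ →ₗ[ℂ] Matrix m m ℂ) (C : Matrix m m ℂ)
    (X : Matrix n n ℂ) : (traceAdjoint T C * X).trace = (C * T X).trace := by
  conv_rhs => rw [Matrix.matrix_eq_sum_single X]
  have h : ∀ i j, Matrix.single i j (X i j) = X i j • Matrix.single i j (1 : ℂ) := fun i j => by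
    simp [Matrix.smul_single]
  simp only [h, map_sum, map_smul, Finset.mul_sum, Matrix.trace_sum, Algebra.mul_smul_comm,
    Matrix.trace_smul, smul_eq_mul]
  rw [Finset.sum_comm]
  have h' : (traceAdjoint T C * X).trace = ∑ i, ∑ j, traceAdjoint T C i j * X j i := by
    simp only [Matrix.trace, Matrix.diag_apply, Matrix.mul_apply]
  rw [h']
  exact Finset.sum_congr rfl fun i _ => Finset.sum_congr rfl fun j _ => mul_comm _ _

theorem traceAdjoint_isPositiveMap {T : Matrix n n ℂ →ₗ[ℂ] Matrix m m ℂ} (hT : IsPositiveMap T) :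
    IsPositiveMap (traceAdjoint T) := by
  intro C hC
  have hnn : ∀ v : n → ℂ, 0 ≤ star v ⬝ᵥ (traceAdjoint T C).mulVec v := fun v => by
    have h : star v ⬝ᵥ (traceAdjoint T C).mulVec v =
        (traceAdjoint T C * Matrix.vecMulVec v (star v)).trace := by
      rw [Matrix.mul_vecMulVec, Matrix.trace_vecMulVec, dotProduct_comm]
    rw [h, trace_traceAdjoint_mul]
    exact trace_mul_nonneg hC (hT _ (Matrix.posSemidef_vecMulVec_self_star v))
  rw [← Matrix.isPositive_toEuclideanLin_iff, LinearMap.isPositive_iff_complex]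
  intro x
  have h : inner ℂ (Matrix.toEuclideanLin (traceAdjoint T C) x) x =
      star (star x.ofLp ⬝ᵥ (traceAdjoint T C).mulVec x.ofLp) := by
    rw [← inner_conj_symm, EuclideanSpace.inner_eq_star_dotProduct, dotProduct_comm]
    simp [Matrix.toLpLin_apply]
  obtain ⟨h1, h2⟩ := Complex.nonneg_iff.1 (hnn x.ofLp)
  rw [h]
  refine ⟨Complex.ext rfl ?_, ?_⟩
  · simp [← h2]
  · simpa using h1

theorem traceAdjoint_one {T : Matrix n n ℂ →ₗ[ℂ] Matrix m m ℂ} (hT : IsTracePreserving T) :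
    traceAdjoint T 1 = 1 := by
  ext i j
  simp only [traceAdjoint, LinearMap.coe_mk, AddHom.coe_mk, Matrix.of_apply, one_mul, hT _]
  rcases eq_or_ne i j with rfl | h
  · simp
  · simp [Matrix.one_apply_ne h, Matrix.trace_single_eq_of_ne _ _ _ h.symm]

end Adjoint
end OperatorNorm


section OperatorNorm

open scoped Matrix.Norms.L2Operator

/-! ### The interpolating function and the entropy inequality. -/

section Interpolation

variable {n : Type*} [Fintype n] [DecidableEq n] {m : Type*} [Fintype m] [DecidableEq m]

theorem isPositiveMap_conj {T : Matrix n n ℂ →ₗ[ℂ] Matrix m m ℂ} (hT : IsPositiveMap T)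
    {H : Matrix n n ℂ} (hH : H.IsHermitian) {S : Matrix m m ℂ} (hS : S.IsHermitian) :
    IsPositiveMap (LinearMap.mulLeft ℂ S ∘ₗ LinearMap.mulRight ℂ S ∘ₗ T ∘ₗ
      LinearMap.mulLeft ℂ H ∘ₗ LinearMap.mulRight ℂ H) := by
  intro X hX
  have h1 := hX.mul_mul_conjTranspose_same H
  have h2 := (hT _ h1).mul_mul_conjTranspose_same S
  rw [hH.eq, hS.eq] at h2
  simpa [mul_assoc] using h2

variable {T : Matrix n n ℂ →ₗ[ℂ] Matrix m m ℂ} {ρ' σ' : Matrix n n ℂ} {ρ σ : Matrix m m ℂ}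

/-- The function interpolating between the trace-norm and the operator-norm contractivity of a
positive trace-preserving map. -/
noncomputable def interp (T : Matrix n n ℂ →ₗ[ℂ] Matrix m m ℂ) (hρ' : ρ'.IsHermitian)
    (hσ' : σ'.IsHermitian) (hρ : ρ.IsHermitian) (hσ : σ.IsHermitian) (z : ℂ) : ℂ :=
  (suppProj hρ * powM hρ z * (powM hσ (-(z / 2)) *
    T (powM hσ' (z / 2) * (ρ' * powM hρ' (-z)) * powM hσ' (z / 2)) * powM hσ (-(z / 2)))).trace

/-- Cyclicity and the adjoint rewrite the function as tr (K ρ'), where K is, up to unitary factors,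
the adjoint of `T` at unitary · projection · unitary. -/
theorem norm_interp_le_of_re_eq_zero (hT : IsPositiveMap T) (hTtr : IsTracePreserving T)
    (hρ' : ρ'.PosSemidef) (htr : ρ'.trace = 1) (hσ' : σ'.IsHermitian) (hρ : ρ.IsHermitian)
    (hσ : σ.IsHermitian) {z : ℂ} (hz : z.re = 0) : ‖interp T hρ'.1 hσ' hρ hσ z‖ ≤ 1 := by
  have hz2 : (z / 2).re = 0 := by simp [hz]
  have hz2' : (-(z / 2)).re = 0 := by simp [hz]
  have hz' : (-z).re = 0 := by simp [hz]
  set Q := powM hσ (-(z / 2)) with hQ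
  set W := powM hσ' (z / 2) with hW
  have hcyc : interp T hρ'.1 hσ' hρ hσ z =
      (powM hρ'.1 (-z) * W * traceAdjoint T (Q * suppProj hρ * (powM hρ z * Q)) * W *
        ρ').trace := by
    have e1 : interp T hρ'.1 hσ' hρ hσ z =
        ((Q * suppProj hρ * (powM hρ z * Q)) * T (W * (ρ' * powM hρ'.1 (-z)) * W)).trace := by
      rw [interp, ← hQ, ← hW, ← mul_assoc _ _ Q, Matrix.trace_mul_comm]
      simp only [mul_assoc]
    rw [e1, ← trace_traceAdjoint_mul,
      show ∀ X : Matrix n n ℂ, X * (W * (ρ' * powM hρ'.1 (-z)) * W) =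
        (X * W * ρ') * (powM hρ'.1 (-z) * W) by intro X; simp only [mul_assoc],
      Matrix.trace_mul_comm]
    simp only [mul_assoc]
  have hb : ‖traceAdjoint T (Q * suppProj hρ * (powM hρ z * Q))‖ ≤ 1 := by
    refine norm_map_unitary_mul_proj_mul_unitary_le (traceAdjoint_isPositiveMap hT) zero_le_one ?_
      (powM_mem_unitary hσ hz2') (suppProj_posSemidef hρ).1 (suppProj_mul_self hρ)
      (mul_mem (powM_mem_unitary hρ hz) (powM_mem_unitary hσ hz2'))
    rw [traceAdjoint_one hTtr]
    simpa using Matrix.PosSemidef.zero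
  rw [hcyc]
  refine (norm_trace_mul_le _ hρ').trans ?_
  rw [htr, Complex.one_re, mul_one, CStarRing.norm_mul_mem_unitary _ (powM_mem_unitary hσ' hz2),
    CStarRing.norm_mem_unitary_mul _ (mul_mem (powM_mem_unitary hρ'.1 hz')
      (powM_mem_unitary hσ' hz2))]
  exact hb

theorem norm_interp_le_of_re_eq_one (hT : IsPositiveMap T)
    (hρ' : ρ'.PosSemidef) (hσ' : σ'.PosSemidef) (hsupp : suppProj hσ'.1 * ρ' = ρ')
    (hρ : ρ.PosSemidef) (htr : ρ.trace = 1)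
    (hσ : σ.PosSemidef) {c : ℝ} (hc : 0 < c) (hTσ : ((c : ℂ) • σ - T σ').PosSemidef)
    {z : ℂ} (hz : z.re = 1) : ‖interp T hρ'.1 hσ'.1 hρ.1 hσ.1 z‖ ≤ c := by
  obtain ⟨w, rfl⟩ : ∃ w, z = 1 + w := ⟨z - 1, by ring⟩
  have hw : w.re = 0 := by simpa using hz
  have hw2 : (w / 2).re = 0 := by simp [hw]
  have hw2' : (-(w / 2)).re = 0 := by simp [hw]
  have hw' : (-w).re = 0 := by simp [hw]
  set H := sqrtM hσ'.1 with hH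
  set S := powM hσ.1 (((-(1 / 2) : ℝ) : ℂ)) with hS
  set V := powM hσ'.1 (w / 2) with hV
  set Q := powM hσ.1 (-(w / 2)) with hQ
  have hSh : S.IsHermitian := powM_ofReal_isHermitian _ _
  set Φ := LinearMap.mulLeft ℂ S ∘ₗ LinearMap.mulRight ℂ S ∘ₗ T ∘ₗ
      LinearMap.mulLeft ℂ H ∘ₗ LinearMap.mulRight ℂ H with hΦ
  have hΦpos : IsPositiveMap Φ := isPositiveMap_conj hT (sqrtM_isHermitian hσ'.1) hSh
  have hΦapp : ∀ X, Φ X = S * T (H * X * H) * S := fun X => by simp [hΦ, mul_assoc]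
  have hSS : S * σ * S = suppProj hσ.1 := by
    rw [hS, powM_mul_self, mul_assoc, ← powM_add, ← self_mul_powM_neg_one hσ]
    norm_num
  -- `S` is the identity on the kernel of σ, so the difference is c times the kernel projection plus
  -- `S` (cσ - T σ') `S`.
  have hΦ1 : ((c : ℂ) • 1 - Φ 1).PosSemidef := by
    have h1 := hTσ.mul_mul_conjTranspose_same S
    have h2 := (one_sub_suppProj_posSemidef hσ.1).smul (a := (c : ℂ)) (by exact_mod_cast hc.le)
    have h3 := h2.add h1
    convert h3 using 1
    rw [hΦapp, mul_one, hH, sqrtM_mul_self hσ', hSh.eq, mul_sub, sub_mul, mul_smul_comm,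
      smul_mul_assoc, hSS]
    module
  have hproj : suppProj hσ'.1 * suppProj hρ'.1 = suppProj hρ'.1 := by
    rw [← self_mul_powM_neg_one hρ', ← mul_assoc, hsupp]
  have hproj' : suppProj hρ'.1 * suppProj hσ'.1 = suppProj hρ'.1 := by
    have := congrArg Matrix.conjTranspose hproj
    rwa [Matrix.conjTranspose_mul, (suppProj_posSemidef hσ'.1).1.eq,
      (suppProj_posSemidef hρ'.1).1.eq] at this
  -- The power 1/2 of σ' is the square root only on its support. As the support of ρ' lies inside
  -- it, the support projection of σ' can be inserted on both sides to produce `H`.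
  have hin : powM hσ'.1 ((1 + w) / 2) * (ρ' * powM hρ'.1 (-(1 + w))) * powM hσ'.1 ((1 + w) / 2) =
      H * (V * suppProj hρ'.1 * (powM hρ'.1 (-w) * V)) * H := by
    have e1 : powM hσ'.1 ((1 + w) / 2) = powM hσ'.1 (1 / 2) * V := by
      rw [hV, ← powM_add]; ring_nf
    have e2 : powM hσ'.1 ((1 + w) / 2) = V * powM hσ'.1 (1 / 2) := by
      rw [hV, ← powM_add]; ring_nf
    have e3 : ρ' * powM hρ'.1 (-(1 + w)) = suppProj hρ'.1 * powM hρ'.1 (-w) := by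
      rw [neg_add, powM_add, ← mul_assoc, self_mul_powM_neg_one hρ']
    have h1 : H = powM hσ'.1 (1 / 2) * suppProj hσ'.1 := (powM_half_mul_suppProj hσ').symm
    have h2 : H = suppProj hσ'.1 * powM hσ'.1 (1 / 2) := by rw [suppProj_mul_powM, ← h1]
    have h3 : suppProj hσ'.1 * V = V * suppProj hσ'.1 := suppProj_mul_powM _ _
    have h4 : suppProj hρ'.1 * powM hρ'.1 (-w) * suppProj hσ'.1 =
        suppProj hρ'.1 * powM hρ'.1 (-w) := by
      rw [suppProj_mul_powM, mul_assoc, hproj']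
    calc _ = powM hσ'.1 (1 / 2) * V * (suppProj hρ'.1 * powM hρ'.1 (-w)) *
          (V * powM hσ'.1 (1 / 2)) := by
          conv_lhs => lhs; lhs; rw [e1]
          rw [e2, e3]
      _ = powM hσ'.1 (1 / 2) * V * ((suppProj hσ'.1 * suppProj hρ'.1) * powM hρ'.1 (-w) *
          suppProj hσ'.1) * (V * powM hσ'.1 (1 / 2)) := by rw [hproj, h4]
      _ = powM hσ'.1 (1 / 2) * (V * suppProj hσ'.1) * suppProj hρ'.1 * powM hρ'.1 (-w) *
          (suppProj hσ'.1 * V) * powM hσ'.1 (1 / 2) := by simp only [mul_assoc]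
      _ = (powM hσ'.1 (1 / 2) * suppProj hσ'.1) * V * suppProj hρ'.1 * powM hρ'.1 (-w) *
          V * (suppProj hσ'.1 * powM hσ'.1 (1 / 2)) := by
          rw [← h3]
          nth_rewrite 2 [h3]
          simp only [mul_assoc]
      _ = _ := by rw [← h1, ← h2]; simp only [mul_assoc]
  have hcyc : interp T hρ'.1 hσ'.1 hρ.1 hσ.1 (1 + w) =
      ((powM hρ.1 w * Q) * Φ (V * suppProj hρ'.1 * (powM hρ'.1 (-w) * V)) * Q * ρ).trace := by
    have e1 : powM hσ.1 (-((1 + w) / 2)) = Q * S := by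
      rw [hQ, hS, ← powM_add]; push_cast; ring_nf
    have e2 : powM hσ.1 (-((1 + w) / 2)) = S * Q := by
      rw [hQ, hS, ← powM_add]; push_cast; ring_nf
    have e3 : suppProj hρ.1 * powM hρ.1 (1 + w) = ρ * powM hρ.1 w := by
      rw [powM_add, ← mul_assoc, suppProj_mul_powM_one hρ]
    rw [Matrix.trace_mul_comm, interp, hin, hΦapp, e3]
    conv_lhs => enter [1, 2, 1, 1]; rw [e1]
    rw [e2]
    simp only [mul_assoc]
  have hb : ‖Φ (V * suppProj hρ'.1 * (powM hρ'.1 (-w) * V))‖ ≤ c :=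
    norm_map_unitary_mul_proj_mul_unitary_le hΦpos hc.le hΦ1
      (powM_mem_unitary hσ'.1 hw2) (suppProj_posSemidef hρ'.1).1 (suppProj_mul_self hρ'.1)
      (mul_mem (powM_mem_unitary hρ'.1 hw') (powM_mem_unitary hσ'.1 hw2))
  rw [hcyc]
  refine (norm_trace_mul_le _ hρ).trans ?_
  rw [htr, Complex.one_re, mul_one, CStarRing.norm_mul_mem_unitary _ (powM_mem_unitary hσ.1 hw2'),
    CStarRing.norm_mem_unitary_mul _ (mul_mem (powM_mem_unitary hρ.1 hw)
      (powM_mem_unitary hσ.1 hw2'))]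
  exact hb

theorem bddAbove_norm_interp (hρ' : ρ'.IsHermitian) (hσ' : σ'.IsHermitian) (hρ : ρ.IsHermitian)
    (hσ : σ.IsHermitian) : ∃ C : ℝ, ∀ z : ℂ, |z.re| ≤ 1 → ‖interp T hρ' hσ' hρ hσ z‖ ≤ C := by
  obtain ⟨Cρ, hCρ, hρb⟩ := exists_norm_powM_le hρ
  obtain ⟨Cσ, hCσ, hσb⟩ := exists_norm_powM_le hσ
  obtain ⟨Cρ', hCρ', hρb'⟩ := exists_norm_powM_le hρ'
  obtain ⟨Cσ', hCσ', hσb'⟩ := exists_norm_powM_le hσ'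
  let τ := LinearMap.toContinuousLinearMap (Matrix.traceLinearMap m ℂ ℂ)
  let T' := LinearMap.toContinuousLinearMap T
  refine ⟨‖τ‖ * (‖suppProj hρ‖ * Cρ * (Cσ * (‖T'‖ * (Cσ' * (‖ρ'‖ * Cρ') * Cσ')) * Cσ)),
    fun z hz => ?_⟩
  have hz2 : |(z / 2).re| ≤ 1 := by
    have : (z / 2).re = z.re / 2 := by simp
    rw [this, abs_div, abs_two]
    linarith
  have hz2' : |(-(z / 2)).re| ≤ 1 := by rwa [Complex.neg_re, abs_neg]
  have hz' : |(-z).re| ≤ 1 := by rwa [Complex.neg_re, abs_neg]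
  refine (τ.le_opNorm _).trans (mul_le_mul_of_nonneg_left ?_ (norm_nonneg _))
  refine (norm_mul_le _ _).trans (mul_le_mul ((norm_mul_le _ _).trans
    (mul_le_mul_of_nonneg_left (hρb z hz) (norm_nonneg _))) ?_ (norm_nonneg _) (by positivity))
  refine norm_mul_le_of_le (norm_mul_le_of_le (hσb _ hz2') ?_) (hσb _ hz2')
  refine (T'.le_opNorm _).trans (mul_le_mul_of_nonneg_left ?_ (norm_nonneg _))
  exact norm_mul_le_of_le (norm_mul_le_of_le (hσb' _ hz2) (norm_mul_le_of_le le_rfl (hρb' _ hz')))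
    (hσb' _ hz2)

/-- The product rule at every point gives the holomorphy for three lines; the value of the
derivative matters only at 0, where all powers are 1. -/
theorem hasDerivAt_interp (hρ' : ρ'.IsHermitian) (hσ' : σ'.IsHermitian) (hρ : ρ.IsHermitian)
    (hσ : σ.IsHermitian) (z : ℂ) :
    ∃ d : ℂ, HasDerivAt (interp T hρ' hσ' hρ hσ) d z ∧ (z = 0 → d =
      (suppProj hρ * logM hρ * T ρ' + suppProj hρ * (-(1 / 2 : ℂ) • logM hσ * T ρ' +
        T ((1 / 2 : ℂ) • logM hσ' * ρ' + -(ρ' * logM hρ') + (1 / 2 : ℂ) • (ρ' * logM hσ')) +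
        -(1 / 2 : ℂ) • (T ρ' * logM hσ))).trace) := by
  let τ := LinearMap.toContinuousLinearMap (Matrix.traceLinearMap m ℂ ℂ)
  let T' := LinearMap.toContinuousLinearMap T
  have hhalf : HasDerivAt (fun z : ℂ => z / 2) (1 / 2) z := (hasDerivAt_id z).div_const 2
  have hnhalf : HasDerivAt (fun z : ℂ => -(z / 2)) (-(1 / 2)) z := hhalf.neg
  have dρ := (hasDerivAt_powM hρ z).const_mul (suppProj hρ)
  have dσ := (hasDerivAt_powM hσ (-(z / 2))).scomp z hnhalf
  have dσ' := (hasDerivAt_powM hσ' (z / 2)).scomp z hhalf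
  have dρ' := ((hasDerivAt_powM hρ' (-z)).scomp z (hasDerivAt_neg z)).const_mul ρ'
  have din := T'.hasFDerivAt.comp_hasDerivAt z ((dσ'.mul dρ').mul dσ')
  have d := τ.hasFDerivAt.comp_hasDerivAt z (dρ.mul ((dσ.mul din).mul dσ))
  refine ⟨_, d, ?_⟩
  rintro rfl
  have hτ : ∀ X, τ X = X.trace := fun _ => rfl
  have hT' : ∀ X, T' X = T X := fun _ => rfl
  simp only [hτ, hT', Function.comp_apply, zero_div, neg_zero, powM_zero, mul_one, one_mul,
    Pi.mul_apply]
  simp only [mul_smul_comm, neg_smul, one_smul, mul_neg]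

theorem re_trace_mul_logM_sub_le (hT : IsPositiveMap T) (hTtr : IsTracePreserving T)
    (hρ' : ρ'.PosSemidef) (htr : ρ'.trace = 1) (hσ' : σ'.PosSemidef)
    (hsupp : suppProj hσ'.1 * ρ' = ρ') (hρ : ρ.PosSemidef) (hTρ : T ρ' = ρ)
    (hσ : σ.PosSemidef) {c : ℝ} (hc : 0 < c) (hTσ : ((c : ℂ) • σ - T σ').PosSemidef) :
    (ρ * (logM hρ.1 - logM hσ.1)).trace.re ≤
      (ρ' * (logM hρ'.1 - logM hσ'.1)).trace.re + Real.log c := by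
  have htrρ : ρ.trace = 1 := by rw [← hTρ, hTtr, htr]
  set G := interp T hρ'.1 hσ'.1 hρ.1 hσ.1 with hG
  have hdiff : ∀ z, DifferentiableAt ℂ G z := fun z =>
    (hasDerivAt_interp hρ'.1 hσ'.1 hρ.1 hσ.1 z).choose_spec.1.differentiableAt
  obtain ⟨d, hd, hd0⟩ := hasDerivAt_interp (T := T) hρ'.1 hσ'.1 hρ.1 hσ.1 0
  have hG0 : G 0 = 1 := by
    simp only [hG, interp, zero_div, neg_zero, powM_zero, mul_one, one_mul, hTρ, suppProj_mul, htrρ]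
  have hbound : ∀ x : ℝ, 0 ≤ x → x ≤ 1 → (G x).re ≤ c ^ x := fun x h0 h1 => by
    have hB : BddAbove ((norm ∘ G) '' Complex.HadamardThreeLines.verticalClosedStrip 0 1) := by
      obtain ⟨C, hC⟩ := bddAbove_norm_interp (T := T) hρ'.1 hσ'.1 hρ.1 hσ.1
      refine ⟨C, ?_⟩
      rintro _ ⟨z, hz, rfl⟩
      exact hC z (abs_le.2 ⟨by linarith [hz.1], hz.2⟩)
    have h := Complex.HadamardThreeLines.norm_le_interp_of_mem_verticalClosedStrip₀₁' G
      (z := (x : ℂ)) (a := 1) (b := c) (by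
        simpa [Complex.HadamardThreeLines.verticalClosedStrip] using ⟨h0, h1⟩)
      (Differentiable.diffContOnCl hdiff) hB
      (fun z hz => norm_interp_le_of_re_eq_zero hT hTtr hρ' htr hσ'.1 hρ.1 hσ.1 hz)
      (fun z hz => norm_interp_le_of_re_eq_one hT hρ' hσ' hsupp hρ htrρ hσ hc hTσ hz)
    rw [Complex.ofReal_re, Real.one_rpow, one_mul] at h
    exact (Complex.re_le_norm _).trans h
  have hderiv : HasDerivAt (fun x : ℝ => c ^ x - (G x).re) (Real.log c - d.re) 0 := by
    have h1 := (Real.hasStrictDerivAt_const_rpow hc 0).hasDerivAt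
    rw [Real.rpow_zero, one_mul] at h1
    have h2 : HasDerivAt G d ((0 : ℝ) : ℂ) := by simpa using hd
    exact h1.sub h2.real_of_complex
  have hle : d.re ≤ Real.log c := by
    -- c^x - Re G(x) vanishes at 0 and is nonnegative on (0, 1), so its derivative at 0 is
    -- nonnegative.
    have h := hderiv.tendsto_slope_zero_right
    refine sub_nonneg.1 (ge_of_tendsto h ?_)
    filter_upwards [Ioo_mem_nhdsGT (zero_lt_one' ℝ)] with t ht
    have := hbound t ht.1.le ht.2.le
    simp only [zero_add, Complex.ofReal_zero, hG0, Real.rpow_zero, Complex.one_re, sub_self,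
      sub_zero, smul_eq_mul]
    exact mul_nonneg (inv_nonneg.2 ht.1.le) (sub_nonneg.2 this)
  -- `M` is positive with tr (M ρ') = tr ((1 - P) ρ) = 0, so it annihilates ρ'. Thus P may be
  -- dropped in tr (P T(Y)) when each term of Y has ρ' as a left or right factor.
  set M := traceAdjoint T (1 - suppProj hρ.1) with hM
  have hMpos : M.PosSemidef := traceAdjoint_isPositiveMap hT _ (one_sub_suppProj_posSemidef hρ.1)
  have hMρ : M * ρ' = 0 := mul_eq_zero_of_trace_mul_eq_zero hMpos hρ' (by
    rw [hM, trace_traceAdjoint_mul, hTρ, sub_mul, suppProj_mul, one_mul, sub_self,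
      Matrix.trace_zero])
  have hρM : ρ' * M = 0 := by
    have := congrArg Matrix.conjTranspose hMρ
    rwa [Matrix.conjTranspose_mul, hMpos.1.eq, hρ'.1.eq, Matrix.conjTranspose_zero] at this
  have hproj : ∀ Y, (M * Y).trace = 0 → (suppProj hρ.1 * T Y).trace = Y.trace := fun Y hY => by
    rw [hM, trace_traceAdjoint_mul, sub_mul, one_mul, Matrix.trace_sub, hTtr] at hY
    exact (sub_eq_zero.1 hY).symm
  have hin : (suppProj hρ.1 * T ((1 / 2 : ℂ) • logM hσ'.1 * ρ' + -(ρ' * logM hρ'.1) +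
      (1 / 2 : ℂ) • (ρ' * logM hσ'.1))).trace =
      (ρ' * logM hσ'.1).trace - (ρ' * logM hρ'.1).trace := by
    rw [hproj]
    · rw [Matrix.trace_add, Matrix.trace_add, Matrix.trace_neg, smul_mul_assoc, Matrix.trace_smul,
        Matrix.trace_smul, Matrix.trace_mul_comm (logM hσ'.1), smul_eq_mul]
      ring
    · have h1 : (M * (logM hσ'.1 * ρ')).trace = 0 := by
        rw [← mul_assoc, Matrix.trace_mul_comm, ← mul_assoc, hρM, zero_mul, Matrix.trace_zero]
      simp only [mul_add, mul_neg, smul_mul_assoc, mul_smul_comm, ← mul_assoc, hMρ, zero_mul,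
        neg_zero, smul_zero, add_zero, Matrix.trace_smul]
      rw [mul_assoc, h1, smul_zero]
  have hdval : d = (ρ * (logM hρ.1 - logM hσ.1)).trace -
      (ρ' * (logM hρ'.1 - logM hσ'.1)).trace := by
    have h1 : (suppProj hρ.1 * logM hρ.1 * ρ).trace = (ρ * logM hρ.1).trace := by
      rw [suppProj_mul_logM, Matrix.trace_mul_comm]
    have h2 : (suppProj hρ.1 * (logM hσ.1 * ρ)).trace = (ρ * logM hσ.1).trace := by
      rw [Matrix.trace_mul_comm, mul_assoc, mul_suppProj, Matrix.trace_mul_comm]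
    rw [hd0 rfl, mul_add, mul_add, Matrix.trace_add, Matrix.trace_add, Matrix.trace_add, hin, hTρ,
      h1, smul_mul_assoc, mul_smul_comm, mul_smul_comm, Matrix.trace_smul, Matrix.trace_smul, h2,
      ← mul_assoc, suppProj_mul, mul_sub, mul_sub, Matrix.trace_sub, Matrix.trace_sub, smul_eq_mul]
    ring
  rw [hdval, Complex.sub_re] at hle
  linarith

end Interpolation
end OperatorNorm


/-! ### Inclusion of supports. -/

section Support

variable {n : Type*} [Fintype n] [DecidableEq n] {m : Type*} [Fintype m] [DecidableEq m]

theorem support_le_iff {ρ σ : Matrix n n ℂ} :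
    support ρ ≤ support σ ↔ ∀ v : n → ℂ, σ.mulVec v = 0 → ρ.mulVec v = 0 := by
  have h : ∀ (A : Matrix n n ℂ) (v : n → ℂ),
      WithLp.toLp 2 v ∈ LinearMap.ker (Matrix.toEuclideanLin A) ↔ A.mulVec v = 0 := fun A v => by
    rw [LinearMap.mem_ker, Matrix.toLpLin_apply]
    simp
  rw [support, support, Submodule.orthogonal_le_orthogonal_iff]
  refine ⟨fun hle v hv => (h _ v).1 (hle ((h _ v).2 hv)), fun hle x hx => ?_⟩
  exact (h _ x.ofLp).2 (hle _ ((h _ x.ofLp).1 hx))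

theorem suppProj_mul_of_support_le {ρ σ : Matrix n n ℂ} (hρ : ρ.IsHermitian) (hσ : σ.IsHermitian)
    (h : support ρ ≤ support σ) : suppProj hσ * ρ = ρ := by
  have h0 : ρ * (1 - suppProj hσ) = 0 := by
    refine Matrix.ext_iff_mulVec.2 fun v => ?_
    rw [← Matrix.mulVec_mulVec, Matrix.zero_mulVec]
    refine support_le_iff.1 h _ ?_
    rw [Matrix.mulVec_mulVec, mul_sub, mul_suppProj, mul_one, sub_self, Matrix.zero_mulVec]
  have h1 := congrArg Matrix.conjTranspose h0
  rw [Matrix.conjTranspose_mul, hρ.eq, (one_sub_suppProj_posSemidef hσ).1.eq,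
    Matrix.conjTranspose_zero, sub_mul, one_mul] at h1
  exact (sub_eq_zero.1 h1).symm

/-- For v in the kernel of N σ, the adjoint of `N` at vv* is positive and trace-orthogonal to σ, so
it annihilates σ, then ρ; hence ⟨v, N(ρ) v⟩ = 0. -/
theorem support_map_le {N : Matrix n n ℂ →ₗ[ℂ] Matrix m m ℂ} (hN : IsPositiveMap N)
    {ρ σ : Matrix n n ℂ} (hρ : ρ.PosSemidef) (hσ : σ.PosSemidef) (h : support ρ ≤ support σ) :
    support (N ρ) ≤ support (N σ) := by
  refine support_le_iff.2 fun v hv => ?_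
  have htr : ∀ X : Matrix n n ℂ, (traceAdjoint N (Matrix.vecMulVec v (star v)) * X).trace =
      star v ⬝ᵥ (N X).mulVec v := fun X => by
    rw [trace_traceAdjoint_mul, Matrix.trace_mul_comm, Matrix.mul_vecMulVec,
      Matrix.trace_vecMulVec, dotProduct_comm]
  have hM := traceAdjoint_isPositiveMap hN _ (Matrix.posSemidef_vecMulVec_self_star v)
  have h0 := mul_eq_zero_of_trace_mul_eq_zero hM hσ (by rw [htr, hv, dotProduct_zero])
  have h1 : traceAdjoint N (Matrix.vecMulVec v (star v)) * ρ = 0 := by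
    rw [← suppProj_mul_of_support_le hρ.1 hσ.1 h, ← self_mul_powM_neg_one hσ, ← mul_assoc,
      ← mul_assoc, h0, zero_mul, zero_mul]
  refine ((hN _ hρ).dotProduct_mulVec_zero_iff v).1 ?_
  rw [← htr, h1, Matrix.trace_zero]

theorem relEntropy_eq {ρ σ : Matrix n n ℂ} (hρ : ρ.IsHermitian) (hσ : σ.IsHermitian)
    (h : support ρ ≤ support σ) : relEntropy ρ σ =
      (((Real.log 2)⁻¹ * (ρ * (logM hρ - logM hσ)).trace.re : ℝ) : EReal) := by
  rw [relEntropy, if_pos h, log2_eq hρ, log2_eq hσ, ← smul_sub, mul_smul_comm, Matrix.trace_smul,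
    smul_eq_mul, ← Complex.ofReal_inv, Complex.re_ofReal_mul]

end Support

/-! ### Tensor powers and the replacement map. -/

section Tensor

variable {a b : Type*}

theorem tensorProd_mul [Fintype a] {n : ℕ} (X Y : Fin n → Matrix a a ℂ) :
    tensorProd (fun t => X t * Y t) = tensorProd X * tensorProd Y := by
  ext i j
  simp only [tensorProd, Matrix.of_apply, Matrix.mul_apply, ← Finset.prod_mul_distrib]
  rw [Finset.prod_univ_sum, Fintype.piFinset_univ]

theorem tensorProd_conjTranspose {n : ℕ} (X : Fin n → Matrix a a ℂ) :
    tensorProd (fun t => (X t).conjTranspose) = (tensorProd X).conjTranspose := by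
  ext i j
  simp [tensorProd]

theorem tensorProd_posSemidef [Fintype a] [DecidableEq a]
    {n : ℕ} {X : Fin n → Matrix a a ℂ} (hX : ∀ t, (X t).PosSemidef) :
    (tensorProd X).PosSemidef := by
  have h : tensorProd X = (tensorProd fun t => sqrtM (hX t).1).conjTranspose *
      tensorProd fun t => sqrtM (hX t).1 := by
    rw [← tensorProd_conjTranspose, ← tensorProd_mul]
    congr 1
    ext1 t
    rw [(sqrtM_isHermitian (hX t).1).eq, sqrtM_mul_self (hX t)]
  rw [h]
  exact Matrix.posSemidef_conjTranspose_mul_self _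

theorem IsTensorStablePositive.isPositiveMap [Fintype a] [DecidableEq a] [Fintype b]
    {N : Matrix a a ℂ →ₗ[ℂ] Matrix b b ℂ}
    (hN : IsTensorStablePositive N) : IsPositiveMap N := by
  intro X hX
  have h := hN 1 _ (tensorProd_posSemidef fun _ : Fin 1 => hX)
  rw [tensorPow_tensorProd] at h
  have h' := h.submatrix fun (i : b) (_ : Fin 1) => i
  convert h' using 1
  ext i j
  simp [tensorProd]

/-- The map that replaces its input by a fixed operator. -/
noncomputable def replaceMap (b : Type*) [Fintype b] (ρ : Matrix a a ℂ) :
    Matrix b b ℂ →ₗ[ℂ] Matrix a a ℂ :=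
  (Matrix.traceLinearMap b ℂ ℂ).smulRight ρ

theorem replaceMap_apply [Fintype b] (ρ : Matrix a a ℂ) (X : Matrix b b ℂ) :
    replaceMap b ρ X = X.trace • ρ := rfl

/-- A product of traces of matrix units is 1 for equal multi-indices and 0 otherwise, so the tensor
power is again a replacement map. -/
theorem tensorPow_replaceMap [Fintype b] [DecidableEq b] (ρ : Matrix a a ℂ) (n : ℕ)
    (X : Matrix (Fin n → b) (Fin n → b) ℂ) :
    tensorPow (replaceMap b ρ) n X = X.trace • tensorProd fun _ => ρ := by
  have h : ∀ k l : Fin n → b, (tensorProd fun t => replaceMap b ρ (Matrix.single (k t) (l t) 1)) =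
      if k = l then tensorProd fun _ => ρ else 0 := fun k l => by
    ext i j
    simp only [replaceMap_apply, tensorProd, Matrix.of_apply, Matrix.smul_apply, smul_eq_mul,
      Finset.prod_mul_distrib]
    split_ifs with hkl
    · subst hkl
      simp
    · obtain ⟨t, ht⟩ := Function.ne_iff.1 hkl
      rw [Finset.prod_eq_zero (Finset.mem_univ t) (Matrix.trace_single_eq_of_ne _ _ _ ht), zero_mul]
      rfl
  simp only [tensorPow, LinearMap.coe_mk, AddHom.coe_mk, h, smul_ite, smul_zero,
    Finset.sum_ite_eq, Finset.mem_univ, if_true, Matrix.trace, Matrix.diag_apply, Finset.sum_smul]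

theorem replaceMap_isTensorStablePositive [Fintype a] [DecidableEq a] [Fintype b] [DecidableEq b]
    {ρ : Matrix a a ℂ} (hρ : ρ.PosSemidef) :
    IsTensorStablePositive (replaceMap b ρ) := fun n X hX => by
  rw [tensorPow_replaceMap]
  exact (tensorProd_posSemidef fun _ => hρ).smul hX.trace_nonneg

theorem replaceMap_isTracePreserving [Fintype a] [Fintype b] {ρ : Matrix a a ℂ} (hρ : ρ.trace = 1) :
    IsTracePreserving (replaceMap b ρ) := fun X => by
  rw [replaceMap_apply, Matrix.trace_smul, hρ, smul_eq_mul, mul_one]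

end Tensor

/-! ### Compactness and attainment of the minimum. -/

section Compactness

variable {a b : Type*}

theorem norm_apply_le_trace [Fintype a] [DecidableEq a]
    {X : Matrix a a ℂ} (hX : X.PosSemidef) (i j : a) :
    ‖X i j‖ ≤ X.trace.re := by
  have hentry : ∀ i j, X i j = inner ℂ (EuclideanSpace.single i (1 : ℂ))
      (Matrix.toEuclideanCLM (𝕜 := ℂ) X (EuclideanSpace.single j 1)) := fun i j => by
    simp [EuclideanSpace.inner_single_left, Matrix.ofLp_toEuclideanCLM]
  have hdiag : ∀ i, (X i i).re ≤ X.trace.re := fun i => by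
    rw [Matrix.trace, Complex.re_sum]
    exact Finset.single_le_sum (f := fun i => (X.diag i).re)
      (fun i _ => (Complex.nonneg_iff.1 hX.diag_nonneg).1) (Finset.mem_univ i)
  have h := norm_inner_posSemidef_le hX (EuclideanSpace.single i 1) (EuclideanSpace.single j 1)
  rw [← hentry, ← hentry, ← hentry] at h
  linarith [hdiag i, hdiag j]

open scoped Matrix.Norms.L2Operator MatrixOrder in
-- For positive `X` the entries of `R X` are bounded by tr (R X) = tr X, whatever `R` is; positive
-- matrices span all matrices.
theorem exists_norm_map_apply_le [Fintype a] [DecidableEq a] [Fintype b] [DecidableEq b]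
    (X : Matrix b b ℂ) :
    ∃ C : ℝ, ∀ R : Matrix b b ℂ →ₗ[ℂ] Matrix a a ℂ, IsTracePreserving R → IsPositiveMap R →
      ∀ i j, ‖R X i j‖ ≤ C := by
  have hX : X ∈ Submodule.span ℂ {A : Matrix b b ℂ | 0 ≤ A} := by
    rw [CStarAlgebra.span_nonneg]; trivial
  induction hX using Submodule.span_induction with
  | mem A hA =>
    refine ⟨A.trace.re, fun R htr hpos i j => ?_⟩
    rw [← htr A]
    exact norm_apply_le_trace (hpos A (Matrix.nonneg_iff_posSemidef.1 hA)) i j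
  | zero => exact ⟨0, fun R _ _ i j => by simp⟩
  | add A B _ _ hA hB =>
    obtain ⟨C, hC⟩ := hA
    obtain ⟨D, hD⟩ := hB
    refine ⟨C + D, fun R htr hpos i j => ?_⟩
    rw [map_add, Matrix.add_apply]
    exact norm_add_le_of_le (hC R htr hpos i j) (hD R htr hpos i j)
  | smul c A _ hA =>
    obtain ⟨C, hC⟩ := hA
    refine ⟨‖c‖ * C, fun R htr hpos i j => ?_⟩
    rw [map_smul, Matrix.smul_apply, smul_eq_mul, norm_mul]
    exact mul_le_mul_of_nonneg_left (hC R htr hpos i j) (norm_nonneg _)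

theorem isClosed_posSemidef [Fintype a] : IsClosed {A : Matrix a a ℂ | A.PosSemidef} := by
  simp only [Matrix.posSemidef_iff_dotProduct_mulVec, Set.ofPred_and, Set.ofPred_forall]
  refine IsClosed.inter (isClosed_eq (by fun_prop) continuous_id) (isClosed_iInter fun x => ?_)
  exact isClosed_le continuous_const (by fun_prop)

/-- The linear map with prescribed values on matrix units. -/
noncomputable def ofUnits [Fintype b]
    (f : b → b → a → a → ℂ) : Matrix b b ℂ →ₗ[ℂ] Matrix a a ℂ where
  toFun X := ∑ k, ∑ l, X k l • Matrix.of (f k l)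
  map_add' X Y := by simp only [Matrix.add_apply, add_smul, Finset.sum_add_distrib]
  map_smul' c X := by
    simp only [Matrix.smul_apply, smul_assoc, Finset.smul_sum, RingHom.id_apply]

theorem ofUnits_map_single [Fintype b] [DecidableEq b] (R : Matrix b b ℂ →ₗ[ℂ] Matrix a a ℂ) :
    ofUnits (fun k l => R (Matrix.single k l 1)) = R := by
  ext1 X
  conv_rhs => rw [Matrix.matrix_eq_sum_single X]
  simp only [ofUnits, LinearMap.coe_mk, AddHom.coe_mk, map_sum]
  refine Finset.sum_congr rfl fun k _ => Finset.sum_congr rfl fun l _ => ?_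
  have h : Matrix.single k l (X k l) = X k l • Matrix.single k l (1 : ℂ) := by
    simp [Matrix.smul_single]
  rw [h, map_smul]
  rfl

theorem ofUnits_single [Fintype b] [DecidableEq b] (f : b → b → a → a → ℂ) (k l : b) :
    ofUnits f (Matrix.single k l 1) = Matrix.of (f k l) := by
  simp only [ofUnits, LinearMap.coe_mk, AddHom.coe_mk]
  rw [Finset.sum_eq_single k, Finset.sum_eq_single l]
  · rw [Matrix.single_apply_same, one_smul]
  · intro l' _ hl
    rw [Matrix.single_apply_of_ne _ _ _ _ _ fun h => hl h.2.symm, zero_smul]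
  · simp
  · intro k' _ hk
    exact Finset.sum_eq_zero fun l' _ => by
      rw [Matrix.single_apply_of_ne _ _ _ _ _ fun h => hk h.1.symm, zero_smul]
  · simp

theorem continuous_ofUnits [Fintype b] (X : Matrix b b ℂ) :
    Continuous fun f : b → b → a → a → ℂ => ofUnits f X := by
  refine continuous_matrix fun i j => ?_
  simp only [ofUnits, LinearMap.coe_mk, AddHom.coe_mk, Matrix.sum_apply, Matrix.smul_apply,
    Matrix.of_apply]
  fun_prop

theorem continuous_tensorPow_ofUnits [Fintype b] [DecidableEq b]
    (n : ℕ) (X : Matrix (Fin n → b) (Fin n → b) ℂ) :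
    Continuous fun f : b → b → a → a → ℂ => tensorPow (ofUnits f) n X := by
  refine continuous_matrix fun i j => ?_
  simp only [tensorPow, tensorProd, LinearMap.coe_mk, AddHom.coe_mk, Matrix.sum_apply,
    Matrix.smul_apply, Matrix.of_apply]
  refine continuous_finsetSum _ fun k _ => continuous_finsetSum _ fun l _ =>
    continuous_const.mul (continuous_finsetProd _ fun t _ => ?_)
  exact (continuous_ofUnits _).matrix_elem _ _

/-- The trace-preserving tensor-stable positive maps recovering `ρ` from `ρ'`, together with the
exponents `γ ≤ γ₀` such that `2 ^ γ σ` dominates the image of `σ'`. -/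
def recoverySet [Fintype a] [Fintype b] [DecidableEq b]
    (ρ σ : Matrix a a ℂ) (ρ' σ' : Matrix b b ℂ) (γ₀ : ℝ) :
    Set ((b → b → a → a → ℂ) × ℝ) :=
  {p | IsTracePreserving (ofUnits p.1) ∧ IsTensorStablePositive (ofUnits p.1) ∧
    ofUnits p.1 ρ' = ρ ∧ p.2 ∈ Set.Icc 0 γ₀ ∧
    (((2 : ℝ) ^ p.2) • σ - ofUnits p.1 σ').PosSemidef}

theorem isCompact_recoverySet [Fintype a] [DecidableEq a] [Fintype b] [DecidableEq b]
    (ρ σ : Matrix a a ℂ) (ρ' σ' : Matrix b b ℂ) (γ₀ : ℝ) :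
    IsCompact (recoverySet ρ σ ρ' σ' γ₀) := by
  choose C hC using fun k l : b => exists_norm_map_apply_le (a := a) (Matrix.single k l (1 : ℂ))
  have hK : IsCompact ((Set.univ.pi fun k => Set.univ.pi fun l => Set.univ.pi fun _ : a =>
      Set.univ.pi fun _ : a => Metric.closedBall (0 : ℂ) (C k l)) ×ˢ Set.Icc 0 γ₀) :=
    (isCompact_univ_pi fun k => isCompact_univ_pi fun l => isCompact_univ_pi fun _ =>
      isCompact_univ_pi fun _ => isCompact_closedBall _ _).prod isCompact_Icc
  refine hK.of_isClosed_subset ?_ ?_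
  · have hcont : ∀ X : Matrix b b ℂ, Continuous fun p : (b → b → a → a → ℂ) × ℝ =>
        ofUnits p.1 X := fun X => (continuous_ofUnits X).comp continuous_fst
    have h1 : IsClosed {p : (b → b → a → a → ℂ) × ℝ | IsTracePreserving (ofUnits p.1)} := by
      simp only [IsTracePreserving, Set.ofPred_forall]
      exact isClosed_iInter fun X => isClosed_eq (hcont X).matrix_trace continuous_const
    have h2 : IsClosed {p : (b → b → a → a → ℂ) × ℝ | IsTensorStablePositive (ofUnits p.1)} := by
      simp only [IsTensorStablePositive, IsPositiveMap, Set.ofPred_forall]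
      exact isClosed_iInter fun n => isClosed_iInter fun X => isClosed_iInter fun _ =>
        isClosed_posSemidef.preimage ((continuous_tensorPow_ofUnits n X).comp continuous_fst)
    have h3 : IsClosed {p : (b → b → a → a → ℂ) × ℝ | ofUnits p.1 ρ' = ρ} :=
      isClosed_eq (hcont _) continuous_const
    have h4 : IsClosed {p : (b → b → a → a → ℂ) × ℝ | p.2 ∈ Set.Icc 0 γ₀} :=
      isClosed_Icc.preimage continuous_snd
    have h5 : IsClosed {p : (b → b → a → a → ℂ) × ℝ |
        (((2 : ℝ) ^ p.2) • σ - ofUnits p.1 σ').PosSemidef} := by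
      have hpow : Continuous fun p : (b → b → a → a → ℂ) × ℝ => (2 : ℝ) ^ p.2 :=
        continuous_const.rpow continuous_snd fun _ => Or.inl two_ne_zero
      exact isClosed_posSemidef.preimage ((hpow.smul continuous_const).sub (hcont σ'))
    exact h1.inter (h2.inter (h3.inter (h4.inter h5)))
  · rintro ⟨f, γ⟩ ⟨htr, hpos, -, hγ, -⟩
    refine ⟨fun k _ l _ i _ j _ => ?_, hγ⟩
    have h := hC k l _ htr hpos.isPositiveMap i j
    rw [mem_closedBall_zero_iff]
    rwa [ofUnits_single] at h

/-- The minimum over recovery maps of the max relative entropy is attained. -/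
theorem exists_isLeast_maxRelEntropy [Fintype a] [DecidableEq a] [Fintype b] [DecidableEq b]
    {ρ σ : Matrix a a ℂ} {ρ' σ' : Matrix b b ℂ}
    (hρ : IsDensity ρ) (hρ' : ρ'.trace = 1) (hσ : 0 < σ.trace.re) (htr : σ'.trace = σ.trace) :
    ∃ m : EReal, IsLeast {d : EReal | ∃ R : Matrix b b ℂ →ₗ[ℂ] Matrix a a ℂ,
      IsTracePreserving R ∧ IsTensorStablePositive R ∧ R ρ' = ρ ∧
        d = maxRelEntropy (R σ') σ} m := by
  -- Taking traces gives (2^γ - 1) tr σ ≥ 0: this is the lower end 0 of the compact range of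
  -- exponents.
  have hnonneg : ∀ R : Matrix b b ℂ →ₗ[ℂ] Matrix a a ℂ, IsTracePreserving R → ∀ γ : ℝ,
      (((2 : ℝ) ^ γ) • σ - R σ').PosSemidef → 0 ≤ γ := fun R hR γ h => by
    have h1 := (Complex.nonneg_iff.1 h.trace_nonneg).1
    rw [Matrix.trace_sub, hR, htr, Matrix.trace_smul, Complex.sub_re, Complex.smul_re,
      smul_eq_mul] at h1
    have h2 : (1 : ℝ) ≤ 2 ^ γ := by
      by_contra! hlt
      nlinarith
    by_contra! hlt
    exact absurd h2 (not_le.2 (Real.rpow_lt_one_of_one_lt_of_neg one_lt_two hlt))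
  by_cases hex : ∃ (R : Matrix b b ℂ →ₗ[ℂ] Matrix a a ℂ) (γ : ℝ), IsTracePreserving R ∧
      IsTensorStablePositive R ∧ R ρ' = ρ ∧ (((2 : ℝ) ^ γ) • σ - R σ').PosSemidef
  · obtain ⟨R₀, γ₀, htr₀, hpos₀, hR₀, hγ₀⟩ := hex
    have hne : (recoverySet ρ σ ρ' σ' γ₀).Nonempty := by
      refine ⟨(fun k l => R₀ (Matrix.single k l 1), γ₀), ?_⟩
      simp only [recoverySet, Set.mem_ofPred_eq, ofUnits_map_single]
      exact ⟨htr₀, hpos₀, hR₀, ⟨hnonneg _ htr₀ _ hγ₀, le_rfl⟩, hγ₀⟩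
    obtain ⟨⟨f, γ⟩, ⟨htrf, hposf, hf, hγ, hfγ⟩, hmin⟩ :=
      (isCompact_recoverySet ρ σ ρ' σ' γ₀).exists_isMinOn hne continuous_snd.continuousOn
    have hlow : ∀ R : Matrix b b ℂ →ₗ[ℂ] Matrix a a ℂ, IsTracePreserving R →
        IsTensorStablePositive R → R ρ' = ρ → (γ : EReal) ≤ maxRelEntropy (R σ') σ := by
      intro R htrR hposR hR
      refine le_sInf ?_
      rintro _ ⟨δ, rfl, hδ⟩
      refine EReal.coe_le_coe_iff.2 ?_
      by_cases hδ₀ : δ ≤ γ₀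
      · refine hmin (a := (fun k l => R (Matrix.single k l 1), δ)) ?_
        simp only [recoverySet, Set.mem_ofPred_eq, ofUnits_map_single]
        exact ⟨htrR, hposR, hR, ⟨hnonneg _ htrR _ hδ, hδ₀⟩, hδ⟩
      -- Exponents above the cutoff `γ₀` cannot beat the minimizer, which lies below it.
      · exact hγ.2.trans (not_le.1 hδ₀).le
    refine ⟨maxRelEntropy (ofUnits f σ') σ, ⟨_, htrf, hposf, hf, rfl⟩, ?_⟩
    rintro _ ⟨R, htrR, hposR, hR, rfl⟩
    have hup : maxRelEntropy (ofUnits f σ') σ ≤ γ := sInf_le ⟨γ, rfl, hfγ⟩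
    exact hup.trans (hlow R htrR hposR hR)
  -- No recovery map has a finite exponent, so every value is `⊤`; the replacement map attains it.
  · have hrep : replaceMap b ρ ρ' = ρ := by rw [replaceMap_apply, hρ', one_smul]
    refine ⟨⊤, ⟨replaceMap b ρ, replaceMap_isTracePreserving hρ.2,
      replaceMap_isTensorStablePositive hρ.1, hrep, ?_⟩, ?_⟩
    · refine (sInf_eq_top.2 ?_).symm
      rintro _ ⟨γ, rfl, hγ⟩
      exact (hex ⟨replaceMap b ρ, γ, replaceMap_isTracePreserving hρ.2,
        replaceMap_isTensorStablePositive hρ.1, hrep, hγ⟩).elim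
    · rintro _ ⟨R, htrR, hposR, hR, rfl⟩
      refine le_sInf ?_
      rintro _ ⟨γ, rfl, hγ⟩
      exact (hex ⟨R, γ, htrR, hposR, hR, hγ⟩).elim

end Compactness

/-! ### Conclusion in base-two logarithms. -/

/-- The relative entropy decreases under a positive map, up to the max relative entropy between the
image of the second argument and the operator that replaces it. -/
theorem relEntropy_sub_le_maxRelEntropy {a b : Type*} [Fintype a] [DecidableEq a] [Fintype b]
    [DecidableEq b] {ρ σ : Matrix a a ℂ} {ρ' σ' : Matrix b b ℂ} (hρ : ρ.PosSemidef)
    (hσ : σ.PosSemidef) (hρ' : IsDensity ρ') (hσ' : σ'.PosSemidef)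
    (hsupp : support ρ ≤ support σ) (hsupp' : support ρ' ≤ support σ')
    {R : Matrix b b ℂ →ₗ[ℂ] Matrix a a ℂ} (hRtr : IsTracePreserving R) (hRpos : IsPositiveMap R)
    (hR : R ρ' = ρ) : relEntropy ρ σ - relEntropy ρ' σ' ≤ maxRelEntropy (R σ') σ := by
  refine le_sInf ?_
  rintro _ ⟨γ, rfl, hγ⟩
  have hc : (0 : ℝ) < 2 ^ γ := Real.rpow_pos_of_pos two_pos γ
  have h := re_trace_mul_logM_sub_le hRpos hRtr hρ'.1 hρ'.2 hσ'
    (suppProj_mul_of_support_le hρ'.1.1 hσ'.1 hsupp') hρ hR hσ hc (by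
      rwa [show ((2 ^ γ : ℝ) : ℂ) • σ = ((2 : ℝ) ^ γ) • σ from Complex.coe_smul _ _])
  rw [Real.log_rpow two_pos] at h
  rw [relEntropy_eq hρ.1 hσ.1 hsupp, relEntropy_eq hρ'.1.1 hσ'.1 hsupp', ← EReal.coe_sub,
    EReal.coe_le_coe_iff, ← mul_sub, inv_mul_le_iff₀ (Real.log_pos one_lt_two)]
  linarith

end QuantumRecovery

theorem proposition2 {a b : Type*} [Fintype a] [DecidableEq a] [Fintype b] [DecidableEq b]
    (σ ρ : Matrix a a ℂ) (hσ : σ.PosSemidef) (hρ : QuantumRecovery.IsDensity ρ)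
    (hsupp : QuantumRecovery.support ρ ≤ QuantumRecovery.support σ)
    (N : Matrix a a ℂ →ₗ[ℂ] Matrix b b ℂ)
    (hNtr : QuantumRecovery.IsTracePreserving N)
    (hNpos : QuantumRecovery.IsTensorStablePositive N) :
    QuantumRecovery.relEntropy ρ σ ≠ ⊤ ∧
    QuantumRecovery.relEntropy (N ρ) (N σ) ≠ ⊤ ∧
    ∃ m : EReal,
      IsLeast {d : EReal | ∃ R : Matrix b b ℂ →ₗ[ℂ] Matrix a a ℂ,
        QuantumRecovery.IsTracePreserving R ∧ QuantumRecovery.IsTensorStablePositive R ∧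
        R (N ρ) = ρ ∧ d = QuantumRecovery.maxRelEntropy (R (N σ)) σ} m ∧
      QuantumRecovery.relEntropy ρ σ - QuantumRecovery.relEntropy (N ρ) (N σ) ≤ m := by
  have hN := hNpos.isPositiveMap
  have hsupp' := QuantumRecovery.support_map_le hN hρ.1 hσ hsupp
  have hρ' : QuantumRecovery.IsDensity (N ρ) := ⟨hN _ hρ.1, by rw [hNtr, hρ.2]⟩
  -- If σ were 0, the support inclusion would force ρ = 0, against tr ρ = 1.
  have hσtr : 0 < σ.trace.re := by
    refine lt_of_le_of_ne (Complex.nonneg_iff.1 hσ.trace_nonneg).1 fun h => ?_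
    have h0 : σ = 0 := hσ.trace_eq_zero_iff.1
      (Complex.ext h.symm (Complex.nonneg_iff.1 hσ.trace_nonneg).2.symm)
    have h1 := QuantumRecovery.suppProj_mul_of_support_le hρ.1.1 hσ.1 hsupp
    rw [← QuantumRecovery.self_mul_powM_neg_one hσ, mul_assoc] at h1
    have h2 : ρ = 0 := by rw [← h1]; simp [h0]
    have h3 := hρ.2
    simp [h2] at h3
  obtain ⟨m, hm⟩ := QuantumRecovery.exists_isLeast_maxRelEntropy hρ hρ'.2 hσtr (hNtr σ)
  refine ⟨?_, ?_, m, hm, ?_⟩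
  · rw [QuantumRecovery.relEntropy_eq hρ.1.1 hσ.1 hsupp]
    exact EReal.coe_ne_top _
  · rw [QuantumRecovery.relEntropy_eq hρ'.1.1 (hN _ hσ).1 hsupp']
    exact EReal.coe_ne_top _
  · obtain ⟨R, hRtr, hRpos, hR, rfl⟩ := hm.1
    exact QuantumRecovery.relEntropy_sub_le_maxRelEntropy hρ.1 hσ hρ' (hN _ hσ) hsupp hsupp' hRtr
      hRpos.isPositiveMap hR
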